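/- Let $(\alpha_k)_{k\ge 0}$ be a sequence of complex numbers with $|\alpha_k|<1$ for all $k$, not all of them zero, and put $\rho_k=\sqrt{1-|\alpha_k|^2}$ and $\Theta_k=\begin{pmatrix}\overline{\alpha_k}&\rho_k\\ \rho_k&-\alpha_k\end{pmatrix}$. Let $\mathcal L=\Theta_0\oplus\Theta_2\oplus\Theta_4\oplus\cdots$ and $\mathcal M=1\oplus\Theta_1\oplus\Theta_3\oplus\cdots$ be the associated block diagonal infinite matrices (rows and columns indexed by $0,1,2,\dots$), and let $\mathcal C=\mathcal L\mathcal M$ be the CMV matrix with Verblunsky coefficients $(\alpha_k)$. For an infinite complex band matrix $\Omega$ put $(\operatorname{ad}\mathcal C)\Omega=\mathcal C\Omega-\Omega\,\mathcal C$, and for an integer $n\ge 0$ define $$(\operatorname{ad}_n\mathcal C)\Omega=\begin{cases}(\mathcal C^\dagger)^m\,\big((\operatorname{ad}\mathcal C)^n\Omega\big)\,(\mathcal C^\dagger)^m, & n=2m,\\ \mathcal L^\dagger(\mathcal C^\dagger)^m\,\big((\operatorname{ad}\mathcal C)^n\Omega\big)\,(\mathcal C^\dagger)^m\mathcal M^\dagger,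 & n=2m+1,\end{cases}$$ where $\dagger$ denotes the conjugate transpose. Call $\Omega$ almost tridiagonal if $\Omega-\widetilde\Omega$ has only finitely many non-zero entries for some tridiagonal infinite matrix $\widetilde\Omega$. If $\Omega$ is almost tridiagonal and $(\operatorname{ad}_n\mathcal C)\Omega=0$ for some integer $n\ge 0$, then $\Omega=cI$ for some $c\in\mathbb C$, where $I$ is the infinite identity matrix. -/

import Mathlib

open scoped Matrix ComplexConjugate

noncomputable section

namespace CMV

/-- Infinite complex matrices with rows and columns indexed by `0, 1, 2, …`. -/
abbrev InfMatrix := Matrix ℕ ℕ ℂ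

/-- The usual row-by-column product of infinite matrices. The sum is finite whenever one of the
two factors is a band matrix, which is the case in every product used below. -/
def mul (A B : InfMatrix) : InfMatrix :=
  Matrix.of fun i j => ∑ᶠ k, A i k * B k j

/-- Powers for the product `mul`. -/
def pow (A : InfMatrix) : ℕ → InfMatrix
  | 0 => 1
  | m + 1 => mul A (pow A m)

/-- `ρ_n = √(1 - |α_n|²)`. -/
def rho (α : ℕ → ℂ) (n : ℕ) : ℝ := √(1 - ‖α n‖ ^ 2)

/-- The matrix `L = Θ₀ ⊕ Θ₂ ⊕ Θ₄ ⊕ ⋯`, where `Θ_n = [[conj α_n, ρ_n], [ρ_n, -α_n]]`; for even `n`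
the block `Θ_n` occupies the rows and columns `n, n + 1`. -/
def matL (α : ℕ → ℂ) : InfMatrix := Matrix.of fun i j =>
  if i = j then (if Even i then conj (α i) else -α (i - 1))
  else if j = i + 1 ∧ Even i then (rho α i : ℂ)
  else if i = j + 1 ∧ Even j then (rho α j : ℂ)
  else 0

/-- The matrix `M = 1 ⊕ Θ₁ ⊕ Θ₃ ⊕ ⋯`; for odd `n` the block `Θ_n` occupies the rows and columns
`n, n + 1`. -/
def matM (α : ℕ → ℂ) : InfMatrix := Matrix.of fun i j =>
  if i = j then (if i = 0 then 1 else if Odd i then conj (α i) else -α (i - 1))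
  else if j = i + 1 ∧ Odd i then (rho α i : ℂ)
  else if i = j + 1 ∧ Odd j then (rho α j : ℂ)
  else 0

/-- The CMV matrix `C = L M` with Verblunsky coefficients `α`. -/
def matC (α : ℕ → ℂ) : InfMatrix := mul (matL α) (matM α)

/-- The commutator operator `(ad A) Ω = A Ω - Ω A`. -/
def ad (A Ω : InfMatrix) : InfMatrix := mul A Ω - mul Ω A

/-- The Hermitian ad-operator `(ad_n C) Ω` of the CMV matrix `C = L M`:
`(C†)^m ((ad C)^n Ω) (C†)^m` for `n = 2 m`, and
`L† (C†)^m ((ad C)^n Ω) (C†)^m M†` for `n = 2 m + 1`. -/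
def hermAd (α : ℕ → ℂ) (n : ℕ) (Ω : InfMatrix) : InfMatrix :=
  let P : InfMatrix := pow (matC α)ᴴ (n / 2)
  let X : InfMatrix := mul (mul P ((ad (matC α))^[n] Ω)) P
  if Even n then X else mul (mul (matL α)ᴴ X) (matM α)ᴴ

/-- Tridiagonal matrices. -/
def IsTridiagonal (T : InfMatrix) : Prop :=
  ∀ i j : ℕ, i + 1 < j ∨ j + 1 < i → T i j = 0

/-- Almost tridiagonal matrices: those that differ from a tridiagonal matrix in at most finitely
many entries. -/
def IsAlmostTridiagonal (Ω : InfMatrix) : Prop :=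
  ∃ T : InfMatrix, IsTridiagonal T ∧ {p : ℕ × ℕ | (Ω - T) p.1 p.2 ≠ 0}.Finite

end CMV

end

/-!
Let `C = L M` act on finitely supported sequences, that is, on polynomials. Each block `Θ_k` with
`|α_k| < 1` raises a degree by exactly one, so the vectors `C ^ s 1`, for `s = 0, 1, -1, 2, -2, …`,
have degrees `0, 1, 2, 3, 4, …`. They form a basis in which `C` is the bilateral shift.

In this basis `C⁻¹ Ω C - Ω` is obtained from `Ω` by taking forward differences along each diagonal,
and `(ad C)^n` is, up to the invertible factor `(-C) ^ n`, its `n`-th iterate. So `ad_n C Ω = 0`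
makes every diagonal polynomial. Since `Ω` is almost tridiagonal it raises large degrees by at most
one, whereas a shift by `l ≠ 0` raises them by at least two at one of the two ends of `ℤ`. Every
off-diagonal therefore vanishes near one end, hence identically, and `Ω` is diagonal in the basis
`C ^ s 1`.

In coordinates `Ω` is then upper triangular. The same holds for `Ωᴴ`, as `C` is unitary, so `Ω` is
diagonal in coordinates as well, and so are all its conjugates by powers of `C`. A nonzero entry
`C i j` now forces equal eigenvalues at two positions, and the conjugates spread this over all
of `ℤ`: the eigenvalue sequence has a period, which is nonzero for some `i, j` because some
`α_k ≠ 0`. A periodic sequence killed by an iterated difference is constant.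
-/

noncomputable section

namespace CMV

open Filter Module Polynomial
open scoped fwdDiff

section ForwardDifference

variable {G : Type*} [AddCommGroup G] {f : ℤ → G}

theorem apply_eq_add_zsmul_of_fwdDiff_eq {g : G} (hf : ∀ s, Δ_[1] f s = g) (s : ℤ) :
    f s = f 0 + s • g := by
  have hper : Function.Periodic (fun t => f t - t • g) 1 := fun t => by
    have := hf t
    rw [fwdDiff, sub_eq_iff_eq_add] at this
    simp only [this, add_zsmul, one_zsmul]
    abel
  simpa [sub_eq_iff_eq_add] using hper.int_mul_eq s

theorem eq_zero_of_fwdDiff_iterate_eq_zero {F : Filter ℤ} [F.NeBot]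
    (hF : Tendsto (· + 1) F F) {n : ℕ} (hn : (Δ_[1])^[n] f = 0) (hf : ∀ᶠ s in F, f s = 0) :
    f = 0 := by
  induction n generalizing f with
  | zero => exact hn
  | succ n ih =>
    have hΔ : Δ_[1] f = 0 := ih hn <| by
      filter_upwards [hf, hF.eventually hf] with s h h'
      rw [fwdDiff, h, h', sub_zero]
    have hconst : ∀ s, f s = f 0 := fun s => by
      simpa using apply_eq_add_zsmul_of_fwdDiff_eq (g := 0) (congrFun hΔ) s
    obtain ⟨s, hs⟩ := hf.exists
    ext t
    rw [hconst, ← hconst s, hs, Pi.zero_apply]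

theorem apply_eq_of_fwdDiff_iterate_eq_zero_of_periodic [IsAddTorsionFree G] {n : ℕ} {p : ℤ}
    (hp : p ≠ 0) (hn : (Δ_[1])^[n] f = 0) (hf : Function.Periodic f p) (s : ℤ) : f s = f 0 := by
  induction n generalizing f s with
  | zero => rw [show f = 0 from hn]; rfl
  | succ n ih =>
    have hΔ : Function.Periodic (Δ_[1] f) p := fun t => by
      simp only [fwdDiff, add_right_comm t p 1, hf _]
    have hlin := apply_eq_add_zsmul_of_fwdDiff_eq (ih hn hΔ)
    have hslope : Δ_[1] f 0 = 0 := by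
      simpa [hf.eq, hp] using hlin p
    rw [hlin, hslope, smul_zero, add_zero]

end ForwardDifference

section ConjDiff

variable {R : Type*} [Ring R] (u : Rˣ)

/-- The multiplicative counterpart of the commutator with a unit `u`: conjugation by `u` minus
the identity. -/
def conjDiff (x : R) : R := ↑u⁻¹ * x * ↑u - x

theorem lie_iterate_eq_mul_conjDiff_iterate (n : ℕ) (x : R) :
    (⁅(u : R), ·⁆)^[n] x = (-u) ^ n * (conjDiff u)^[n] x := by
  induction n with
  | zero => simp
  | succ n ih =>
    have hcomm : (u : R) * (-u) ^ n = (-u) ^ n * u :=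
      (Commute.refl (u : R)).neg_right.pow_right n
    rw [Function.iterate_succ_apply', Function.iterate_succ_apply', ih, Ring.lie_def, conjDiff,
      ← mul_assoc, hcomm, pow_succ]
    simp [mul_sub, mul_assoc, neg_add_eq_sub]

theorem conjDiff_iterate_eq_zero_of_lie_iterate_eq_zero {n : ℕ} {x : R}
    (h : (⁅(u : R), ·⁆)^[n] x = 0) : (conjDiff u)^[n] x = 0 := by
  rw [lie_iterate_eq_mul_conjDiff_iterate] at h
  exact ((u.isUnit.neg.pow n).mul_right_eq_zero).1 h

end ConjDiff

section Shift

variable {K V : Type*} [CommRing K] [AddCommGroup V] [Module K V] (b : Basis ℤ K V)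

/-- The diagonal of offset `l` of the two-sided infinite matrix of `T` in the basis `b`. -/
def diagonal (T : End K V) (l : ℤ) : ℤ → K := fun s => b.repr (T (b s)) (s + l)

variable {b}

theorem apply_eq_smul_of_diagonal_eq_zero {T : End K V} (hT : ∀ l ≠ 0, diagonal b T l = 0)
    (s : ℤ) : T (b s) = diagonal b T 0 s • b s := by
  refine b.ext_elem fun t => ?_
  obtain rfl | hts := eq_or_ne t s
  · simp [diagonal]
  · simpa [diagonal, hts.symm] using congrFun (hT (t - s) (sub_ne_zero.2 hts)) s

variable {u : (End K V)ˣ} (hu : ∀ s, (u : End K V) (b s) = b (s + 1))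
include hu

theorem repr_inv_shift_apply (v : V) (t : ℤ) :
    b.repr ((↑u⁻¹ : End K V) v) t = b.repr v (t + 1) := by
  have hlin : b.coord t ∘ₗ (↑u⁻¹ : End K V) = b.coord (t + 1) := b.ext fun s => by
    have hinv : (↑u⁻¹ : End K V) (b s) = b (s - 1) := by
      rw [← sub_add_cancel s 1, ← hu, ← Module.End.mul_apply, u.inv_mul]
      simp
    simp [hinv, Finsupp.single_apply, sub_eq_iff_eq_add]
  exact LinearMap.congr_fun hlin v

theorem diagonal_conjDiff (T : End K V) (l : ℤ) :
    diagonal b (conjDiff u T) l = Δ_[1] (diagonal b T l) := by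
  ext s
  simp [diagonal, conjDiff, fwdDiff, hu, repr_inv_shift_apply hu, add_right_comm s l 1]

theorem diagonal_conjDiff_iterate (T : End K V) (l : ℤ) (n : ℕ) :
    diagonal b ((conjDiff u)^[n] T) l = (Δ_[1])^[n] (diagonal b T l) := by
  induction n with
  | zero => rfl
  | succ n ih =>
    rw [Function.iterate_succ_apply', diagonal_conjDiff hu, ih, Function.iterate_succ_apply']

theorem fwdDiff_iterate_diagonal_eq_zero {T : End K V} {n : ℕ} (hT : (conjDiff u)^[n] T = 0)
    (l : ℤ) : (Δ_[1])^[n] (diagonal b T l) = 0 := by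
  rw [← diagonal_conjDiff_iterate hu, hT]
  ext s
  simp [diagonal]

end Shift

section DegreeFlag

theorem map_mem_degreeLT {R : Type*} [Semiring R] {T : R[X] →ₗ[R] R[X]} {m n : ℕ}
    (hT : ∀ i < m, T (X ^ i) ∈ degreeLT R n) {w : R[X]} (hw : w ∈ degreeLT R m) :
    T w ∈ degreeLT R n := by
  classical
  rw [degreeLT_eq_span_X_pow] at hw
  refine (Submodule.span_le (p := (degreeLT R n).comap T)).2 (fun x hx => ?_) hw
  simp only [Finset.coe_image, Finset.coe_range, Set.mem_image] at hx
  obtain ⟨i, hi, rfl⟩ := hx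
  exact hT i hi

theorem degree_map_eq_succ {R : Type*} [CommRing R] [NoZeroDivisors R] {T : End R R[X]}
    {w : R[X]} {j : ℕ} (hT : ∀ i < j, T (X ^ i) ∈ degreeLT R (j + 1))
    (hj : (T (X ^ j)).degree = (j + 1 : ℕ)) (hw : w.degree = j) :
    (T w).degree = (j + 1 : ℕ) := by
  have hw0 : w ≠ 0 := degree_ne_bot.1 (hw ▸ WithBot.coe_ne_bot)
  have htail : T w.eraseLead ∈ degreeLT R (j + 1) :=
    map_mem_degreeLT hT (mem_degreeLT.2 (hw ▸ degree_eraseLead_lt hw0))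
  have hlead : (T (w.leadingCoeff • X ^ j)).degree = (j + 1 : ℕ) := by
    rw [map_smul, smul_eq_C_mul, degree_C_mul (leadingCoeff_ne_zero.2 hw0), hj]
  rw [← w.eraseLead_add_C_mul_X_pow, natDegree_eq_of_degree_eq_some hw, ← smul_eq_C_mul, map_add,
    degree_add_eq_right_of_degree_lt (hlead ▸ mem_degreeLT.1 htail), hlead]

variable {K : Type*} [Field K] (Q : Sequence K)

theorem sequence_leadingCoeff_isUnit (i : ℕ) : IsUnit (Q i).leadingCoeff :=
  isUnit_iff_ne_zero.2 (leadingCoeff_ne_zero.2 (Q.ne_zero i))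

theorem sequence_basis_repr_eq_zero {w : K[X]} {n t : ℕ} (hw : w ∈ degreeLT K n) (ht : n ≤ t) :
    (Q.basis (sequence_leadingCoeff_isUnit Q)).repr w t = 0 := by
  set b := Q.basis (sequence_leadingCoeff_isUnit Q)
  rw [← Q.span_degreeLT fun i _ => sequence_leadingCoeff_isUnit Q i,
    show ⇑Q = b from funext fun i => (Q.basis_eq_self _ i).symm, b.mem_span_image] at hw
  by_contra h
  exact ht.not_gt (hw (Finsupp.mem_support_iff.2 h))

variable {Q}

theorem map_X_pow_sub_smul_mem_degreeLT {T : End K K[X]} {c : ℕ → K}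
    (hT : ∀ j, T (Q j) = c j • Q j) (j : ℕ) : T (X ^ j) - c j • X ^ j ∈ degreeLT K j := by
  have hX : (X ^ j : K[X]) ∈ Submodule.span K (Q '' Set.Iio (j + 1)) := by
    rw [Q.span_degreeLT fun i _ => sequence_leadingCoeff_isUnit Q i, mem_degreeLT, degree_X_pow]
    exact_mod_cast j.lt_succ_self
  refine (Submodule.span_le (p := (degreeLT K j).comap (T - c j • 1))).2 ?_ hX
  rintro _ ⟨i, hi, rfl⟩
  have hQi : (T - c j • 1) (Q i) = (c i - c j) • Q i := by simp [hT, sub_smul]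
  rw [SetLike.mem_coe, Submodule.mem_comap, hQi]
  obtain rfl | hij := (Nat.lt_succ_iff.1 hi).eq_or_lt
  · simp
  · refine Submodule.smul_mem _ _ (mem_degreeLT.2 ?_)
    rw [Q.degree_eq]
    exact_mod_cast hij

theorem coeff_map_X_pow_of_le {T : End K K[X]} {c : ℕ → K} (hT : ∀ j, T (Q j) = c j • Q j)
    {i j : ℕ} (hji : j ≤ i) : (T (X ^ j)).coeff i = c j * (X ^ j : K[X]).coeff i := by
  have hdeg := mem_degreeLT.1 (map_X_pow_sub_smul_mem_degreeLT hT j)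
  simpa [sub_eq_zero] using (degree_lt_iff_coeff_zero _ _).1 hdeg i hji

end DegreeFlag

section OperatorMatrix

theorem basisMonomials_constr_X_pow (v : ℕ → ℂ[X]) (j : ℕ) :
    (basisMonomials ℂ).constr ℂ v (X ^ j) = v j := by
  simpa [X_pow_eq_monomial] using (basisMonomials ℂ).constr_basis ℂ v j

theorem end_ext_X_pow {S T : End ℂ ℂ[X]} (h : ∀ j, S (X ^ j) = T (X ^ j)) : S = T :=
  (basisMonomials ℂ).ext fun j => by simpa [X_pow_eq_monomial] using h j

/-- The infinite matrix of a linear operator in the monomial basis of `ℂ[X]`. Polynomials stand for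
finitely supported sequences, so that `X ^ j` is the `j`-th coordinate vector. -/
def toMatrix : End ℂ ℂ[X] →ₗ[ℂ] InfMatrix where
  toFun T := Matrix.of fun i j => (T (X ^ j)).coeff i
  map_add' S T := by ext; simp
  map_smul' c T := by ext; simp

theorem toMatrix_apply (T : End ℂ ℂ[X]) (i j : ℕ) : toMatrix T i j = (T (X ^ j)).coeff i := rfl

theorem toMatrix_injective : Function.Injective toMatrix := fun _ _ h =>
  end_ext_X_pow fun j => Polynomial.ext fun i => congrFun₂ h i j

theorem coeff_apply_eq_finsum (T : End ℂ ℂ[X]) (p : ℂ[X]) (i : ℕ) :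
    (T p).coeff i = ∑ᶠ k, toMatrix T i k * p.coeff k := by
  conv_lhs => rw [p.as_sum_support_C_mul_X_pow]
  rw [map_sum, finsetSum_coeff, finsum_eq_sum_of_support_subset (s := p.support)]
  · refine Finset.sum_congr rfl fun k _ => ?_
    rw [← smul_eq_C_mul, map_smul, coeff_smul, smul_eq_mul, mul_comm, toMatrix_apply]
  · exact fun k hk => mem_support_iff.2 (right_ne_zero_of_mul hk)

theorem toMatrix_mul (S T : End ℂ ℂ[X]) : toMatrix (S * T) = mul (toMatrix S) (toMatrix T) := by
  ext i j
  exact coeff_apply_eq_finsum S (T (X ^ j)) i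

theorem toMatrix_one : toMatrix 1 = 1 := by
  ext i j
  simp [toMatrix_apply, coeff_X_pow, Matrix.one_apply]

theorem toMatrix_pow (T : End ℂ ℂ[X]) (m : ℕ) : toMatrix (T ^ m) = pow (toMatrix T) m := by
  induction m with
  | zero => exact toMatrix_one
  | succ m ih => rw [pow_succ', toMatrix_mul, ih, pow]

theorem toMatrix_lie_iterate (S T : End ℂ ℂ[X]) (n : ℕ) :
    toMatrix ((⁅S, ·⁆)^[n] T) = (ad (toMatrix S))^[n] (toMatrix T) :=
  (show Function.Semiconj toMatrix (⁅S, ·⁆) (ad (toMatrix S)) from fun T => by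
    simp only [Ring.lie_def, map_sub, toMatrix_mul, ad]).iterate_right n T

theorem exists_toMatrix_eq {A : InfMatrix} (hA : ∀ j, (Function.support fun i => A i j).Finite) :
    ∃ T, toMatrix T = A := by
  refine ⟨(basisMonomials ℂ).constr ℂ fun j => ∑ i ∈ (hA j).toFinset, monomial i (A i j), ?_⟩
  ext i j
  rw [toMatrix_apply, basisMonomials_constr_X_pow]
  simp +contextual [coeff_monomial, eq_comm]

/-- `S` and `T` are formal adjoints for the inner product that makes the monomials orthonormal. -/
def IsAdjoint (S T : End ℂ ℂ[X]) : Prop := toMatrix T = (toMatrix S)ᴴ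

theorem conjTranspose_mul (A B : InfMatrix) : (mul A B)ᴴ = mul Bᴴ Aᴴ := by
  ext i j
  exact (AddEquiv.map_finsum starAddEquiv _).trans (finsum_congr fun k => star_mul _ _)

variable {S T S' T' : End ℂ ℂ[X]}

theorem IsAdjoint.coeff_eq (h : IsAdjoint S T) (i j : ℕ) :
    (S (X ^ j)).coeff i = conj ((T (X ^ i)).coeff j) := by
  rw [← toMatrix_apply T, h, Matrix.conjTranspose_apply, toMatrix_apply]
  exact (star_star _).symm

theorem IsAdjoint.symm (h : IsAdjoint S T) : IsAdjoint T S := by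
  rw [IsAdjoint, h, Matrix.conjTranspose_conjTranspose]

theorem IsAdjoint.mul (h : IsAdjoint S T) (h' : IsAdjoint S' T') :
    IsAdjoint (S * S') (T' * T) := by
  rw [IsAdjoint, toMatrix_mul, toMatrix_mul, h, h', conjTranspose_mul]

theorem IsAdjoint.sub (h : IsAdjoint S T) (h' : IsAdjoint S' T') :
    IsAdjoint (S - S') (T - T') := by
  rw [IsAdjoint, map_sub, map_sub, h, h', Matrix.conjTranspose_sub]

theorem IsAdjoint.eq_zero (h : IsAdjoint S T) (hS : S = 0) : T = 0 :=
  toMatrix_injective <| by rw [h, hS, map_zero, Matrix.conjTranspose_zero]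

theorem isAdjoint_one : IsAdjoint 1 1 := by
  rw [IsAdjoint, toMatrix_one, Matrix.conjTranspose_one]

theorem IsAdjoint.pow (h : IsAdjoint S T) (m : ℕ) : IsAdjoint (S ^ m) (T ^ m) := by
  induction m with
  | zero => exact isAdjoint_one
  | succ m ih => rw [pow_succ, pow_succ']; exact ih.mul h

theorem IsAdjoint.apply_X_pow_eq_smul (h : IsAdjoint S T) {Q : Sequence ℂ} {c d : ℕ → ℂ}
    (hS : ∀ j, S (Q j) = c j • Q j) (hT : ∀ j, T (Q j) = d j • Q j) (j : ℕ) :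
    S (X ^ j) = c j • X ^ j := by
  ext i
  rw [coeff_smul, smul_eq_mul]
  obtain hji | hij := le_or_gt j i
  · exact coeff_map_X_pow_of_le hS hji
  · rw [h.coeff_eq, coeff_map_X_pow_of_le hT hij.le]
    simp [coeff_X_pow, hij.ne, hij.ne']

theorem coeff_apply_of_apply_X_pow_eq_smul {c : ℕ → ℂ} (hS : ∀ j, S (X ^ j) = c j • X ^ j)
    (w : ℂ[X]) (i : ℕ) : (S w).coeff i = c i * w.coeff i := by
  rw [coeff_apply_eq_finsum, finsum_eq_single _ i fun k hk => ?_] <;> rw [toMatrix_apply, hS]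
  · simp
  · simp [coeff_X_pow, hk.symm]

variable {u : (End ℂ ℂ[X])ˣ}

theorem IsAdjoint.zpow (hu : IsAdjoint (u : End ℂ ℂ[X]) ↑u⁻¹) (k : ℤ) :
    IsAdjoint (↑(u ^ k) : End ℂ ℂ[X]) ↑(u ^ k)⁻¹ := by
  cases k with
  | ofNat m => simpa using hu.pow m
  | negSucc m => simpa [zpow_negSucc] using hu.symm.pow (m + 1)

theorem IsAdjoint.conj (hu : IsAdjoint (u : End ℂ ℂ[X]) ↑u⁻¹) (h : IsAdjoint S T) :
    IsAdjoint (↑u⁻¹ * S * ↑u) (↑u⁻¹ * T * ↑u) := by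
  simpa only [mul_assoc] using (hu.symm.mul h).mul hu

theorem IsAdjoint.conjDiff_iterate (hu : IsAdjoint (u : End ℂ ℂ[X]) ↑u⁻¹) (h : IsAdjoint S T)
    (n : ℕ) : IsAdjoint ((conjDiff u)^[n] S) ((conjDiff u)^[n] T) := by
  induction n with
  | zero => exact h
  | succ n ih =>
    rw [Function.iterate_succ_apply', Function.iterate_succ_apply']
    exact (hu.conj ih).sub ih

end OperatorMatrix

section BlockOperator

/-- The direct sum of the blocks `Θ_k` for `k` satisfying `p`, as an operator on `ℂ[X]`, where `p`
is assumed to hold for every other index: `p = Even` gives `L` and `p = Odd` gives `M`. -/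
def blockOp (p : ℕ → Prop) [DecidablePred p] (α : ℕ → ℂ) : End ℂ ℂ[X] :=
  (basisMonomials ℂ).constr ℂ fun j =>
    if p j then conj (α j) • X ^ j + (rho α j : ℂ) • X ^ (j + 1)
    else if j = 0 then 1
    else (rho α (j - 1) : ℂ) • X ^ (j - 1) - α (j - 1) • X ^ j

variable {p : ℕ → Prop} [DecidablePred p] (hp : ∀ j, p (j + 1) ↔ ¬ p j) (α : ℕ → ℂ)

theorem blockOp_X_pow {j : ℕ} (hj : p j) :
    blockOp p α (X ^ j) = conj (α j) • X ^ j + (rho α j : ℂ) • X ^ (j + 1) := by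
  rw [blockOp, basisMonomials_constr_X_pow, if_pos hj]

include hp in
theorem blockOp_X_pow_succ {j : ℕ} (hj : p j) :
    blockOp p α (X ^ (j + 1)) = (rho α j : ℂ) • X ^ j - α j • X ^ (j + 1) := by
  rw [blockOp, basisMonomials_constr_X_pow, if_neg (by simpa [hp] using hj), if_neg j.succ_ne_zero,
    Nat.add_sub_cancel]

theorem blockOp_one (h0 : ¬ p 0) : blockOp p α 1 = 1 := by
  rw [← pow_zero X, blockOp, basisMonomials_constr_X_pow, if_neg h0, if_pos rfl, pow_zero]

include hp in
theorem toMatrix_blockOp_apply (i j : ℕ) : toMatrix (blockOp p α) i j =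
    if i = j then (if p i then conj (α i) else if i = 0 then 1 else -α (i - 1))
    else if j = i + 1 ∧ p i then (rho α i : ℂ)
    else if i = j + 1 ∧ p j then (rho α j : ℂ)
    else 0 := by
  rw [toMatrix_apply, blockOp, basisMonomials_constr_X_pow]
  split_ifs <;> simp only [coeff_add, coeff_sub, coeff_smul, coeff_X_pow, coeff_one, smul_eq_mul,
    mul_ite, mul_one, mul_zero] <;> grind

theorem toMatrix_blockOp_even : toMatrix (blockOp Even α) = matL α := by
  ext i j
  rw [toMatrix_blockOp_apply fun _ => Nat.even_add_one]
  simp only [matL, Matrix.of_apply]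
  grind

theorem toMatrix_blockOp_odd : toMatrix (blockOp Odd α) = matM α := by
  ext i j
  rw [toMatrix_blockOp_apply fun _ => Nat.odd_add_one]
  simp only [matM, Matrix.of_apply]
  grind

theorem rho_star : rho (star α) = rho α := by
  ext k
  rw [rho, rho, Pi.star_apply, norm_star]

include hp in
theorem isAdjoint_blockOp : IsAdjoint (blockOp p α) (blockOp p (star α)) := by
  ext i j
  rw [Matrix.conjTranspose_apply, toMatrix_blockOp_apply hp, toMatrix_blockOp_apply hp, rho_star]
  obtain rfl | hij := eq_or_ne i j
  · split_ifs <;> simp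
  · simp only [if_neg hij, if_neg hij.symm]
    split_ifs <;> first | lia | simp

variable {α}

theorem mul_conj_add_rho_sq {k : ℕ} (hα : ‖α k‖ ≤ 1) :
    α k * conj (α k) + (rho α k : ℂ) ^ 2 = 1 := by
  rw [Complex.mul_conj, rho]
  norm_cast
  rw [Real.sq_sqrt (by nlinarith [norm_nonneg (α k)]), Complex.normSq_eq_norm_sq]
  ring

include hp in
theorem blockOp_star_mul_blockOp (hα : ∀ k, ‖α k‖ ≤ 1) :
    blockOp p (star α) * blockOp p α = 1 := by
  have hblock : ∀ k, α k * conj (α k) + (rho α k : ℂ) ^ 2 = 1 := fun k =>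
    mul_conj_add_rho_sq (hα k)
  refine end_ext_X_pow fun j => ?_
  rw [Module.End.mul_apply, Module.End.one_apply]
  by_cases hj : p j
  · rw [blockOp_X_pow α hj, map_add, map_smul, map_smul, blockOp_X_pow _ hj,
      blockOp_X_pow_succ hp _ hj, rho_star, Pi.star_apply, ← starRingEnd_apply, Complex.conj_conj]
    linear_combination (norm := module) hblock j • (X ^ j : ℂ[X])
  rcases j with _ | j
  · rw [pow_zero, blockOp_one α hj, blockOp_one _ hj]
  · replace hj : p j := by simpa [hp] using hj
    rw [blockOp_X_pow_succ hp α hj, map_sub, map_smul, map_smul, blockOp_X_pow _ hj,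
      blockOp_X_pow_succ hp _ hj, rho_star, Pi.star_apply, ← starRingEnd_apply, Complex.conj_conj]
    linear_combination (norm := module) hblock j • (X ^ (j + 1) : ℂ[X])

/-- `blockOp p α` as a unit; its inverse is its adjoint. -/
def blockUnit (hα : ∀ k, ‖α k‖ ≤ 1) : (End ℂ ℂ[X])ˣ where
  val := blockOp p α
  inv := blockOp p (star α)
  val_inv := by
    simpa using blockOp_star_mul_blockOp hp (α := star α) (by simpa using hα)
  inv_val := blockOp_star_mul_blockOp hp hα

theorem rho_ne_zero {k : ℕ} (hα : ‖α k‖ < 1) : (rho α k : ℂ) ≠ 0 :=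
  Complex.ofReal_ne_zero.2 (Real.sqrt_pos.2 (by nlinarith [norm_nonneg (α k)])).ne'

include hp in
theorem degree_blockOp {w : ℂ[X]} {j : ℕ} (hj : p j) (hα : ‖α j‖ < 1) (hw : w.degree = j) :
    (blockOp p α w).degree = (j + 1 : ℕ) := by
  refine degree_map_eq_succ (fun i hi => ?_) ?_ hw
  · refine mem_degreeLT.2 ((degree_lt_iff_coeff_zero _ _).2 fun k hk => ?_)
    rw [← toMatrix_apply, toMatrix_blockOp_apply hp]
    grind
  · rw [blockOp_X_pow α hj, smul_eq_C_mul, smul_eq_C_mul, degree_add_eq_right_of_degree_lt] <;>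
      rw [degree_C_mul_X_pow _ (rho_ne_zero hα)]
    exact (degree_C_mul_X_pow_le _ _).trans_lt (by exact_mod_cast j.lt_succ_self)

end BlockOperator

section CMVOperator

/-- The operator `C = L M` on `ℂ[X]`, as a unit. -/
def cmvUnit {α : ℕ → ℂ} (hα : ∀ k, ‖α k‖ < 1) : (End ℂ ℂ[X])ˣ :=
  blockUnit (p := Even) (fun _ => Nat.even_add_one) (fun k => (hα k).le) *
    blockUnit (p := Odd) (fun _ => Nat.odd_add_one) fun k => (hα k).le

variable {α : ℕ → ℂ} (hα : ∀ k, ‖α k‖ < 1)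

theorem coe_cmvUnit : (cmvUnit hα : End ℂ ℂ[X]) = blockOp Even α * blockOp Odd α := rfl

theorem coe_inv_cmvUnit :
    (↑(cmvUnit hα)⁻¹ : End ℂ ℂ[X]) = blockOp Odd (star α) * blockOp Even (star α) := by
  rw [cmvUnit, mul_inv_rev]
  rfl

theorem toMatrix_cmvUnit : toMatrix (cmvUnit hα) = matC α := by
  rw [coe_cmvUnit, toMatrix_mul, toMatrix_blockOp_even, toMatrix_blockOp_odd, matC]

theorem isAdjoint_cmvUnit : IsAdjoint (cmvUnit hα : End ℂ ℂ[X]) ↑(cmvUnit hα)⁻¹ := by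
  rw [coe_cmvUnit, coe_inv_cmvUnit]
  exact (isAdjoint_blockOp (fun _ => Nat.even_add_one) α).mul
    (isAdjoint_blockOp (fun _ => Nat.odd_add_one) α)

theorem conjDiff_iterate_eq_zero_of_hermAd_eq_zero {n : ℕ} {T : End ℂ ℂ[X]}
    (h : hermAd α n (toMatrix T) = 0) : (conjDiff (cmvUnit hα))^[n] T = 0 := by
  have hC : (toMatrix (cmvUnit hα))ᴴ = toMatrix ↑(cmvUnit hα)⁻¹ :=
    Eq.symm (isAdjoint_cmvUnit hα)
  have hL : (matL α)ᴴ = toMatrix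
      ↑(blockUnit (p := Even) (fun _ => Nat.even_add_one) fun k => (hα k).le)⁻¹ := by
    rw [← toMatrix_blockOp_even, ← isAdjoint_blockOp fun _ => Nat.even_add_one]
    rfl
  have hM : (matM α)ᴴ = toMatrix
      ↑(blockUnit (p := Odd) (fun _ => Nat.odd_add_one) fun k => (hα k).le)⁻¹ := by
    rw [← toMatrix_blockOp_odd, ← isAdjoint_blockOp fun _ => Nat.odd_add_one]
    rfl
  refine conjDiff_iterate_eq_zero_of_lie_iterate_eq_zero _ ?_
  simp only [hermAd, ← toMatrix_cmvUnit hα, hC, hL, hM, ← toMatrix_lie_iterate,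
    ← toMatrix_pow, ← toMatrix_mul, ← Units.val_pow_eq_pow_val] at h
  split_ifs at h <;>
    simpa only [map_eq_zero_iff toMatrix toMatrix_injective, Units.mul_left_eq_zero,
      Units.mul_right_eq_zero] using h

end CMVOperator

section OrbitBasis

/-- The enumeration `0, 1, -1, 2, -2, …` of the integers, listing the powers of the CMV operator in
the order in which they reach the successive degrees. -/
def level : ℤ ≃ ℕ := (Equiv.neg ℤ).trans Equiv.intEquivNat

theorem level_neg_natCast (m : ℕ) : level (-m) = 2 * m := by
  change Equiv.natSumNatEquivNat (Equiv.intEquivNatSumNat (- -(m : ℤ))) = 2 * m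
  rw [neg_neg]
  exact congrFun Equiv.natSumNatEquivNat_apply (Sum.inl m)

theorem level_natCast_add_one (m : ℕ) : level (m + 1) = 2 * m + 1 := by
  change Equiv.natSumNatEquivNat (Equiv.intEquivNatSumNat (-(m + 1 : ℤ))) = 2 * m + 1
  rw [← Int.negSucc_eq]
  exact congrFun Equiv.natSumNatEquivNat_apply (Sum.inr m)

theorem level_of_pos {s : ℤ} (hs : 0 < s) : (level s : ℤ) = 2 * s - 1 := by
  obtain ⟨m, rfl⟩ := Int.le.dest hs
  rw [zero_add, add_comm, level_natCast_add_one]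
  lia

theorem level_of_nonpos {s : ℤ} (hs : s ≤ 0) : (level s : ℤ) = -2 * s := by
  obtain ⟨m, hm⟩ := Int.exists_eq_neg_ofNat hs
  rw [hm, level_neg_natCast]
  lia

theorem tendsto_level {F : Filter ℤ} (hF : F ≤ cofinite) : Tendsto level F atTop := by
  rw [← Nat.cofinite_eq_atTop]
  exact level.injective.tendsto_cofinite.mono_left hF

variable {α : ℕ → ℂ} (hα : ∀ k, ‖α k‖ < 1)

theorem degree_cmvUnit_pow_succ (m : ℕ) :
    (((cmvUnit hα : End ℂ ℂ[X]) ^ (m + 1)) 1).degree = (2 * m + 1 : ℕ) := by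
  induction m with
  | zero =>
    rw [zero_add, pow_one, coe_cmvUnit, Module.End.mul_apply, blockOp_one α (by decide)]
    exact degree_blockOp (fun _ => Nat.even_add_one) (by decide) (hα 0) degree_one
  | succ m ih =>
    rw [pow_succ', Module.End.mul_apply, coe_cmvUnit, Module.End.mul_apply]
    exact degree_blockOp (fun _ => Nat.even_add_one) (by grind) (hα _)
      (degree_blockOp (fun _ => Nat.odd_add_one) (by grind) (hα _) ih)

theorem degree_inv_cmvUnit_pow (m : ℕ) :
    (((↑(cmvUnit hα)⁻¹ : End ℂ ℂ[X]) ^ m) 1).degree = (2 * m : ℕ) := by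
  have hα' : ∀ k, ‖star α k‖ < 1 := by simpa using hα
  induction m with
  | zero => exact degree_one
  | succ m ih =>
    rw [pow_succ', Module.End.mul_apply, coe_inv_cmvUnit, Module.End.mul_apply]
    exact degree_blockOp (fun _ => Nat.odd_add_one) (by grind) (hα' _)
      (degree_blockOp (fun _ => Nat.even_add_one) (by grind) (hα' _) ih)

theorem degree_cmvUnit_zpow (s : ℤ) :
    ((↑(cmvUnit hα ^ s) : End ℂ ℂ[X]) 1).degree = level s := by
  obtain ⟨m, rfl | rfl⟩ : ∃ m : ℕ, s = m + 1 ∨ s = -m := ⟨(max (s - 1) (-s)).toNat, by lia⟩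
  · rw [level_natCast_add_one, ← degree_cmvUnit_pow_succ, ← Nat.cast_succ, zpow_natCast,
      Units.val_pow_eq_pow_val]
  · rw [level_neg_natCast, ← degree_inv_cmvUnit_pow, zpow_neg, zpow_natCast, ← inv_pow,
      Units.val_pow_eq_pow_val]

/-- The polynomials `C ^ s 1`, `s ∈ ℤ`, in the order of their degrees. -/
def orbitSequence : Sequence ℂ where
  elems' j := (↑(cmvUnit hα ^ level.symm j) : End ℂ ℂ[X]) 1
  degree_eq' j := by rw [degree_cmvUnit_zpow, level.apply_symm_apply]

theorem orbitSequence_apply (j : ℕ) :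
    orbitSequence hα j = (↑(cmvUnit hα ^ level.symm j) : End ℂ ℂ[X]) 1 := rfl

/-- The basis `C ^ s 1`, `s ∈ ℤ`, of `ℂ[X]`, on which `C` acts as the bilateral shift. -/
def orbitBasis : Basis ℤ ℂ ℂ[X] :=
  ((orbitSequence hα).basis (sequence_leadingCoeff_isUnit _)).reindex level.symm

theorem orbitBasis_apply (s : ℤ) : orbitBasis hα s = (↑(cmvUnit hα ^ s) : End ℂ ℂ[X]) 1 := by
  rw [orbitBasis, Basis.reindex_apply, Sequence.basis_eq_self, orbitSequence_apply,
    Equiv.symm_symm, Equiv.symm_apply_apply]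

theorem orbitBasis_level_symm (j : ℕ) : orbitBasis hα (level.symm j) = orbitSequence hα j :=
  orbitBasis_apply hα _

theorem cmvUnit_zpow_apply_orbitBasis (k s : ℤ) :
    (↑(cmvUnit hα ^ k) : End ℂ ℂ[X]) (orbitBasis hα s) = orbitBasis hα (s + k) := by
  rw [orbitBasis_apply, orbitBasis_apply, ← Module.End.mul_apply, ← Units.val_mul, ← zpow_add,
    add_comm]

theorem cmvUnit_apply_orbitBasis (s : ℤ) :
    (cmvUnit hα : End ℂ ℂ[X]) (orbitBasis hα s) = orbitBasis hα (s + 1) := by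
  simpa using cmvUnit_zpow_apply_orbitBasis hα 1 s

theorem orbitBasis_mem_degreeLT (s : ℤ) : orbitBasis hα s ∈ degreeLT ℂ (level s + 1) := by
  rw [mem_degreeLT, orbitBasis_apply, degree_cmvUnit_zpow]
  exact_mod_cast Nat.lt_succ_self _

theorem orbitBasis_repr_eq_zero {w : ℂ[X]} {n : ℕ} {t : ℤ} (hw : w ∈ degreeLT ℂ n)
    (ht : n ≤ level t) : (orbitBasis hα).repr w t = 0 := by
  rw [orbitBasis, Basis.repr_reindex_apply]
  exact sequence_basis_repr_eq_zero _ hw ht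

end OrbitBasis

section AlmostHessenberg

/-- Almost upper Hessenberg matrices: in all but finitely many rows, every entry to the left of the
subdiagonal vanishes. -/
def IsAlmostHessenberg (A : InfMatrix) : Prop := ∀ᶠ i in atTop, ∀ j, j + 1 < i → A i j = 0

theorem IsAlmostTridiagonal.isAlmostHessenberg {A : InfMatrix} (hA : IsAlmostTridiagonal A) :
    IsAlmostHessenberg A := by
  obtain ⟨T, hT, hfin⟩ := hA
  rw [IsAlmostHessenberg, ← Nat.cofinite_eq_atTop]
  filter_upwards [(hfin.image Prod.fst).eventually_cofinite_notMem] with i hi j hij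
  by_contra hne
  exact hi ⟨(i, j), by simpa [hT i j (.inr hij)] using hne, rfl⟩

theorem IsAlmostTridiagonal.conjTranspose {A : InfMatrix} (hA : IsAlmostTridiagonal A) :
    IsAlmostTridiagonal Aᴴ := by
  obtain ⟨T, hT, hfin⟩ := hA
  refine ⟨Tᴴ, fun i j hij => ?_,
    (hfin.image Prod.swap).subset fun p hp => ⟨p.swap, ?_, p.swap_swap⟩⟩
  · rw [Matrix.conjTranspose_apply, hT j i hij.symm, star_zero]
  · simpa [← map_sub] using hp

theorem IsAlmostHessenberg.finite_support_col {A : InfMatrix} (hA : IsAlmostHessenberg A) (j : ℕ) :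
    (Function.support fun i => A i j).Finite := by
  have hzero : ∀ᶠ i in cofinite, A i j = 0 := by
    rw [Nat.cofinite_eq_atTop]
    filter_upwards [hA, eventually_gt_atTop (j + 1)] with i hi hij using hi j hij
  exact eventually_cofinite.1 hzero

variable {T : End ℂ ℂ[X]} (hT : IsAlmostHessenberg (toMatrix T))
include hT

theorem IsAlmostHessenberg.eventually_map_mem_degreeLT :
    ∀ᶠ n in atTop, ∀ w ∈ degreeLT ℂ n, T w ∈ degreeLT ℂ (n + 1) := by
  filter_upwards [eventually_forall_ge_atTop.2 hT] with n hn w hw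
  refine map_mem_degreeLT (fun j hj => ?_) hw
  refine mem_degreeLT.2 ((degree_lt_iff_coeff_zero _ _).2 fun i hi => ?_)
  exact hn i (by lia) j (by lia)

variable {α : ℕ → ℂ} (hα : ∀ k, ‖α k‖ < 1)

theorem IsAlmostHessenberg.eventually_diagonal_eq_zero {F : Filter ℤ} (hF : F ≤ cofinite) {l : ℤ}
    (hl : ∀ᶠ s in F, level s + 2 ≤ level (s + l)) :
    ∀ᶠ s in F, diagonal (orbitBasis hα) T l s = 0 := by
  have hlevel : Tendsto (fun s => level s + 1) F atTop :=
    (tendsto_add_atTop_nat 1).comp (tendsto_level hF)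
  filter_upwards [hl, hlevel.eventually hT.eventually_map_mem_degreeLT] with s hs hmap
  exact orbitBasis_repr_eq_zero hα (hmap _ (orbitBasis_mem_degreeLT hα s)) hs

theorem IsAlmostHessenberg.diagonal_eq_zero {n : ℕ} (hn : (conjDiff (cmvUnit hα))^[n] T = 0)
    {l : ℤ} (hl : l ≠ 0) : diagonal (orbitBasis hα) T l = 0 := by
  have hΔ := fwdDiff_iterate_diagonal_eq_zero (cmvUnit_apply_orbitBasis hα) hn l
  obtain hneg | hpos := hl.lt_or_gt
  · refine eq_zero_of_fwdDiff_iterate_eq_zero (F := atBot)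
      (tendsto_atBot_add_const_right _ _ tendsto_id) hΔ
      (hT.eventually_diagonal_eq_zero hα atBot_le_cofinite ?_)
    filter_upwards [eventually_le_atBot 0] with s hs
    have h₁ := level_of_nonpos hs
    have h₂ := level_of_nonpos (s := s + l) (by lia)
    lia
  · refine eq_zero_of_fwdDiff_iterate_eq_zero (F := atTop)
      (tendsto_atTop_add_const_right _ _ tendsto_id) hΔ
      (hT.eventually_diagonal_eq_zero hα atTop_le_cofinite ?_)
    filter_upwards [eventually_gt_atTop 0] with s hs
    have h₁ := level_of_pos hs
    have h₂ := level_of_pos (s := s + l) (by lia)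
    lia

theorem IsAlmostHessenberg.exists_apply_orbitBasis_eq_smul {n : ℕ}
    (hn : (conjDiff (cmvUnit hα))^[n] T = 0) :
    ∃ c : ℤ → ℂ, (∀ s, T (orbitBasis hα s) = c s • orbitBasis hα s) ∧ (Δ_[1])^[n] c = 0 := by
  refine ⟨_, apply_eq_smul_of_diagonal_eq_zero fun l hl => hT.diagonal_eq_zero hα hn hl,
    fwdDiff_iterate_diagonal_eq_zero (cmvUnit_apply_orbitBasis hα) hn 0⟩

end AlmostHessenberg

section Eigenvalues

variable {α : ℕ → ℂ} (hα : ∀ k, ‖α k‖ < 1)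

theorem cmvUnit_X_pow_odd (m : ℕ) : (cmvUnit hα : End ℂ ℂ[X]) (X ^ (2 * m + 1)) =
    conj (α (2 * m + 1)) • ((rho α (2 * m) : ℂ) • X ^ (2 * m) - α (2 * m) • X ^ (2 * m + 1)) +
      (rho α (2 * m + 1) : ℂ) • (conj (α (2 * m + 2)) • X ^ (2 * m + 2) +
        (rho α (2 * m + 2) : ℂ) • X ^ (2 * m + 3)) := by
  rw [coe_cmvUnit, Module.End.mul_apply, blockOp_X_pow _ (by grind), map_add, map_smul, map_smul,
    blockOp_X_pow_succ (fun _ => Nat.even_add_one) _ (by grind), blockOp_X_pow _ (by grind)]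

theorem exists_cmvUnit_coeff_ne_zero (hα0 : ∃ k, α k ≠ 0) :
    ∃ i j, ((cmvUnit hα : End ℂ ℂ[X]) (X ^ j)).coeff i ≠ 0 ∧
      level.symm j + 1 - level.symm i ≠ 0 := by
  obtain ⟨k, hk⟩ := hα0
  have hodd : ∀ m : ℕ, level.symm (2 * m + 1) = m + 1 := fun m => by
    rw [← level_natCast_add_one, level.symm_apply_apply]
  have heven : ∀ m : ℕ, level.symm (2 * m) = -m := fun m => by
    rw [← level_neg_natCast, level.symm_apply_apply]
  rcases k with _ | k
  · refine ⟨0, 0, ?_, by simp⟩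
    rw [coe_cmvUnit, Module.End.mul_apply, pow_zero, blockOp_one α (by decide), ← pow_zero X,
      blockOp_X_pow α (by decide)]
    simpa using hk
  obtain ⟨m, rfl | rfl⟩ := k.even_or_odd'
  · refine ⟨2 * m, 2 * m + 1, ?_, by rw [hodd, heven]; lia⟩
    rw [cmvUnit_X_pow_odd]
    simpa [coeff_X_pow, rho_ne_zero (hα _)] using hk
  · refine ⟨2 * (m + 1), 2 * m + 1, ?_, by rw [hodd, heven]; lia⟩
    rw [cmvUnit_X_pow_odd]
    simpa [coeff_X_pow, mul_add, rho_ne_zero (hα _)] using hk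

variable {S T : End ℂ ℂ[X]} {c d : ℤ → ℂ} {i j : ℕ}

theorem conj_cmvUnit_zpow_apply_orbitBasis
    (hS : ∀ s, S (orbitBasis hα s) = c s • orbitBasis hα s) (k s : ℤ) :
    (↑(cmvUnit hα ^ k)⁻¹ * S * ↑(cmvUnit hα ^ k)) (orbitBasis hα s) =
      c (s + k) • orbitBasis hα s := by
  rw [Module.End.mul_apply, Module.End.mul_apply, cmvUnit_zpow_apply_orbitBasis, hS, map_smul,
    ← zpow_neg, cmvUnit_zpow_apply_orbitBasis, add_neg_cancel_right]

theorem IsAdjoint.apply_X_pow_eq_smul_of_orbitBasis (h : IsAdjoint S T)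
    (hS : ∀ s, S (orbitBasis hα s) = c s • orbitBasis hα s)
    (hT : ∀ s, T (orbitBasis hα s) = d s • orbitBasis hα s) (j : ℕ) :
    S (X ^ j) = c (level.symm j) • X ^ j := by
  refine h.apply_X_pow_eq_smul (Q := orbitSequence hα) (c := fun j => c (level.symm j))
    (d := fun j => d (level.symm j)) ?_ ?_ j <;> intro j <;> rw [← orbitBasis_level_symm]
  exacts [hS _, hT _]

theorem IsAdjoint.eigenvalue_eq_of_coeff_ne_zero (h : IsAdjoint S T)
    (hS : ∀ s, S (orbitBasis hα s) = c s • orbitBasis hα s)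
    (hT : ∀ s, T (orbitBasis hα s) = d s • orbitBasis hα s)
    (hij : ((cmvUnit hα : End ℂ ℂ[X]) (X ^ j)).coeff i ≠ 0) :
    c (level.symm j + 1) = c (level.symm i) := by
  have hS' := conj_cmvUnit_zpow_apply_orbitBasis hα hS 1
  have hT' := conj_cmvUnit_zpow_apply_orbitBasis hα hT 1
  rw [zpow_one] at hS' hT'
  have hconj := ((isAdjoint_cmvUnit hα).conj h).apply_X_pow_eq_smul_of_orbitBasis hα hS' hT' j
  have hmap : S ((cmvUnit hα : End ℂ ℂ[X]) (X ^ j)) =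
      c (level.symm j + 1) • (cmvUnit hα : End ℂ ℂ[X]) (X ^ j) := by
    rw [← map_smul, ← hconj, ← Module.End.mul_apply, ← Module.End.mul_apply]
    simp [mul_assoc]
  have hcoeff := coeff_apply_of_apply_X_pow_eq_smul (h.apply_X_pow_eq_smul_of_orbitBasis hα hS hT)
    ((cmvUnit hα : End ℂ ℂ[X]) (X ^ j)) i
  rw [hmap, coeff_smul, smul_eq_mul] at hcoeff
  exact mul_right_cancel₀ hij hcoeff

theorem IsAdjoint.periodic_eigenvalue (h : IsAdjoint S T)
    (hS : ∀ s, S (orbitBasis hα s) = c s • orbitBasis hα s)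
    (hT : ∀ s, T (orbitBasis hα s) = d s • orbitBasis hα s)
    (hij : ((cmvUnit hα : End ℂ ℂ[X]) (X ^ j)).coeff i ≠ 0) :
    Function.Periodic c (level.symm j + 1 - level.symm i) := fun s => by
  have hshift := (((isAdjoint_cmvUnit hα).zpow (s - level.symm i)).conj
    h).eigenvalue_eq_of_coeff_ne_zero hα (conj_cmvUnit_zpow_apply_orbitBasis hα hS _)
    (conj_cmvUnit_zpow_apply_orbitBasis hα hT _) hij
  convert hshift using 2 <;> ring

theorem eq_smul_one_of_apply_orbitBasis (hS : ∀ s, S (orbitBasis hα s) = c s • orbitBasis hα s)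
    (hc : ∀ s, c s = c 0) : S = c 0 • 1 :=
  (orbitBasis hα).ext fun s => by rw [hS, hc]; rfl

end Eigenvalues

end CMV

end

theorem mainTheorem1 (α : ℕ → ℂ) (hα : ∀ k, ‖α k‖ < 1) (hα0 : ∃ k, α k ≠ 0)
    (n : ℕ) (Ω : CMV.InfMatrix) (hΩ : CMV.IsAlmostTridiagonal Ω)
    (had : CMV.hermAd α n Ω = 0) :
    ∃ c : ℂ, Ω = c • (1 : CMV.InfMatrix) := by
  have hS := hΩ.isAlmostHessenberg
  have hT := hΩ.conjTranspose.isAlmostHessenberg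
  obtain ⟨S, rfl⟩ := CMV.exists_toMatrix_eq hS.finite_support_col
  obtain ⟨T, hST⟩ := CMV.exists_toMatrix_eq hT.finite_support_col
  rw [← hST] at hT
  have hST : CMV.IsAdjoint S T := hST
  have hSn := CMV.conjDiff_iterate_eq_zero_of_hermAd_eq_zero hα had
  have hTn := ((CMV.isAdjoint_cmvUnit hα).conjDiff_iterate hST n).eq_zero hSn
  obtain ⟨c, hc, hcn⟩ := hS.exists_apply_orbitBasis_eq_smul hα hSn
  obtain ⟨d, hd, -⟩ := hT.exists_apply_orbitBasis_eq_smul hα hTn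
  obtain ⟨i, j, hij, hperiod⟩ := CMV.exists_cmvUnit_coeff_ne_zero hα hα0
  have hconst := CMV.apply_eq_of_fwdDiff_iterate_eq_zero_of_periodic hperiod hcn
    (hST.periodic_eigenvalue hα hc hd hij)
  exact ⟨c 0, by rw [CMV.eq_smul_one_of_apply_orbitBasis hα hc hconst, map_smul, CMV.toMatrix_one]⟩
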